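/- Let \[ S(x,y,z) = \frac{1}{1-(x+y+z)+\frac34\,(xy+yz+zx)} \] be Szegő's rational function, expanded as a power series in $x,y,z$ about the origin, and for every integer $n \ge 0$ let \[ s_n = [(xyz)^n]\, S(2x,2y,2z) \] be the coefficient of $x^n y^n z^n$ in the power series of $S(2x,2y,2z)$. Then $s_n > 0$ for all integers $n \ge 0$. -/

import Mathlib

/-- The denominator `1 - (x + y + z) + (3/4) (x y + y z + z x)` of Szegő's rational function,
as a power series in the variables `x = X 0`, `y = X 1`, `z = X 2`. -/
noncomputable def szegoDenominator : MvPowerSeries (Fin 3) ℝ :=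
  1 - (MvPowerSeries.X 0 + MvPowerSeries.X 1 + MvPowerSeries.X 2)
    + MvPowerSeries.C (3 / 4 : ℝ) *
      (MvPowerSeries.X 0 * MvPowerSeries.X 1 + MvPowerSeries.X 1 * MvPowerSeries.X 2
        + MvPowerSeries.X 2 * MvPowerSeries.X 0)

/-- The Taylor expansion at the origin of Szegő's rational function
`S(x, y, z) = 1 / (1 - (x + y + z) + (3/4) (x y + y z + z x))`. -/
noncomputable def szegoS : MvPowerSeries (Fin 3) ℝ :=
  szegoDenominator⁻¹

/-- The denominator has constant term `1`, so that `szegoS` is a genuine inverse. -/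
theorem szegoDenominator_mul_szegoS : szegoDenominator * szegoS = 1 := by
  refine MvPowerSeries.mul_inv_cancel _ ?_
  simp [szegoDenominator]

/-- `S(2x, 2y, 2z)`. -/
noncomputable def szegoScaled : MvPowerSeries (Fin 3) ℝ :=
  MvPowerSeries.rescale (fun _ => (2 : ℝ)) szegoS

/-- The diagonal coefficient `s_n = [(x y z)^n] S(2x, 2y, 2z)`, that is, the coefficient of
the monomial in which each of the three variables has exponent `n`. -/
noncomputable def szegoDiagonal (n : ℕ) : ℝ :=
  MvPowerSeries.coeff (Finsupp.equivFunOnFinite.symm (fun _ : Fin 3 => n)) szegoScaled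

/-! Put a = 1 - 2x and b = 2 - 3x. The scaled denominator is (a - b y) - (b - 3y) z, so the
coefficient of zⁿ is (b - 3y)ⁿ / (a - b y)ⁿ⁺¹. The coefficient of yⁿ in that is 3ⁿ a⁻ⁿ⁻¹ Pₙ(1 + 2u),
with Pₙ the Legendre polynomial and u = (1 - 3x)² / (3a); this is `coeff_eq_szegoSlice`, and s_n is
then its coefficient of xⁿ (`szegoDiagonal_eq`).

The Legendre relations permit creative telescoping in x (`szegoSlice_telescoping`): a combination of
three consecutive slices equals x G' - (n+2) G, which has no xⁿ⁺² term. This yields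
`szegoDiagonal_recurrence`. Its limiting characteristic equation 2λ² - 81λ + 729 = 0 has roots 27/2
and 27; the bound s_{n+1} ≥ 18 s_n, with 18 between the roots, propagates from n = 2 and forces
positivity. -/

/-! ### Legendre polynomials in a shifted variable -/

open Polynomial in
/-- The Legendre polynomial `∑ k, C(n,k) C(n+k,k) Xᵏ`, i.e. `Pₙ(1 + 2X)`. -/
noncomputable def legendreShift (n : ℕ) : ℝ[X] :=
  ∑ k ∈ Finset.range (n + 1), C ((n.choose k : ℝ) * ((n + k).choose k : ℝ)) * X ^ k

theorem coeff_legendreShift (n k : ℕ) :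
    (legendreShift n).coeff k = (n.choose k : ℝ) * ((n + k).choose k : ℝ) := by
  simp only [legendreShift, Polynomial.finsetSum_coeff, Polynomial.coeff_C_mul_X_pow]
  rw [Finset.sum_ite_eq]
  split_ifs with h
  · rfl
  · rw [Nat.choose_eq_zero_of_lt (by simpa using h)]
    simp

theorem legendreShift_coeff_zero (n : ℕ) : (legendreShift n).coeff 0 = 1 := by
  simp [coeff_legendreShift]

theorem legendreShift_coeff_succ_left (n k : ℕ) :
    ((n : ℝ) + 1 - k) * (legendreShift (n + 1)).coeff k =
      (n + 1 + k) * (legendreShift n).coeff k := by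
  rw [coeff_legendreShift, coeff_legendreShift]
  have h1 : ((n : ℝ) + 1 - k) * ((n + 1).choose k : ℝ) = (n + 1) * (n.choose k : ℝ) := by
    rcases le_or_gt k (n + 1) with hk | hk
    · have h := Nat.choose_mul_succ_eq n k
      have h' : (n.choose k : ℝ) * (n + 1) = ((n + 1).choose k : ℝ) * ((n + 1 - k : ℕ) : ℝ) := by
        exact_mod_cast h
      rw [Nat.cast_sub hk] at h'
      push_cast at h'
      linarith
    · rw [Nat.choose_eq_zero_of_lt hk, Nat.choose_eq_zero_of_lt (by omega)]
      simp
  have h2 : ((n : ℝ) + 1) * ((n + 1 + k).choose k : ℝ) = (n + 1 + k) * ((n + k).choose k : ℝ) := by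
    have h := Nat.choose_mul_succ_eq (n + k) k
    rw [show n + k + 1 - k = n + 1 by omega, show n + k + 1 = n + 1 + k by omega] at h
    have h' : ((n + k).choose k : ℝ) * (n + 1 + k) = ((n + 1 + k).choose k : ℝ) * (n + 1) := by
      exact_mod_cast h
    linarith
  linear_combination ((n + 1 + k).choose k : ℝ) * h1 + (n.choose k : ℝ) * h2

theorem legendreShift_coeff_succ_right (n k : ℕ) :
    ((k : ℝ) + 1) ^ 2 * (legendreShift n).coeff (k + 1) =
      (n - k) * (n + k + 1) * (legendreShift n).coeff k := by
  rw [coeff_legendreShift, coeff_legendreShift]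
  have h1 : ((k : ℝ) + 1) * (n.choose (k + 1) : ℝ) = (n - k) * (n.choose k : ℝ) := by
    rcases le_or_gt k n with hk | hk
    · have h := Nat.choose_succ_right_eq n k
      have h' : (n.choose (k + 1) : ℝ) * (k + 1) = (n.choose k : ℝ) * ((n - k : ℕ) : ℝ) := by
        exact_mod_cast h
      rw [Nat.cast_sub hk] at h'
      linarith
    · rw [Nat.choose_eq_zero_of_lt hk, Nat.choose_eq_zero_of_lt (by omega)]
      simp
  have h2 : ((k : ℝ) + 1) * ((n + (k + 1)).choose (k + 1) : ℝ) =
      (n + k + 1) * ((n + k).choose k : ℝ) := by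
    have h := Nat.add_one_mul_choose_eq (n + k) k
    have h' : ((n : ℝ) + k + 1) * ((n + k).choose k : ℝ) =
        ((n + (k + 1)).choose (k + 1) : ℝ) * (k + 1) := by
      exact_mod_cast h
    linarith
  linear_combination ((k : ℝ) + 1) * ((n + (k + 1)).choose (k + 1) : ℝ) * h1 +
    (n - k) * (n.choose k : ℝ) * h2

-- Bonnet's recurrence at t = 1 + 2X.
open Polynomial in
theorem legendreShift_recurrence (n : ℕ) :
    ((n : ℝ[X]) + 2) * legendreShift (n + 2) =
      (2 * (n : ℝ[X]) + 3) * (1 + 2 * X) * legendreShift (n + 1) -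
        ((n : ℝ[X]) + 1) * legendreShift n := by
  have hC2 : (C 2 : ℝ[X]) = 2 := map_ofNat C 2
  have hC3 : (C 3 : ℝ[X]) = 3 := map_ofNat C 3
  have e1 : ((n : ℝ[X]) + 2) * legendreShift (n + 2) = C ((n : ℝ) + 2) * legendreShift (n + 2) := by
    simp [hC2]
  have e2 : (2 * (n : ℝ[X]) + 3) * (1 + 2 * X) * legendreShift (n + 1) -
      ((n : ℝ[X]) + 1) * legendreShift n = C (2 * (n : ℝ) + 3) * legendreShift (n + 1) +
        X * (C (2 * (2 * (n : ℝ) + 3)) * legendreShift (n + 1)) -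
        C ((n : ℝ) + 1) * legendreShift n := by
    simp [hC2, hC3]; ring
  rw [e1, e2]
  ext k
  rcases k with _ | k
  · simp [legendreShift_coeff_zero]; ring
  · simp only [coeff_add, coeff_sub, coeff_C_mul, coeff_X_mul]
    -- After this scaling every coefficient of index k + 1 becomes a multiple of one of index k, and
    -- the shifts in n finish.
    have hk : ((k : ℝ) + 1) ^ 2 ≠ 0 := by positivity
    apply mul_left_cancel₀ hk
    have h1 := legendreShift_coeff_succ_right (n + 2) k
    have h2 := legendreShift_coeff_succ_right (n + 1) k
    have h3 := legendreShift_coeff_succ_right n k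
    have h4 := legendreShift_coeff_succ_left (n + 1) k
    have h5 := legendreShift_coeff_succ_left n k
    push_cast at h1 h2 h3 h4 h5
    linear_combination ((n : ℝ) + 2) * h1 - (2 * n + 3) * h2 + (n + 1) * h3 +
      (n + 2) * (n + k + 3) * h4 - (n + 1) * (n - k) * h5

-- The classical (t² - 1) Pₙ' = (n+1)(Pₙ₊₁ - t Pₙ) at t = 1 + 2X, where t² - 1 = 4X(1 + X) and d/dX
-- = 2 d/dt.
open Polynomial in
theorem legendreShift_derivative (n : ℕ) :
    2 * X * (1 + X) * derivative (legendreShift n) =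
      ((n : ℝ[X]) + 1) * (legendreShift (n + 1) - (1 + 2 * X) * legendreShift n) := by
  have hC2 : (C 2 : ℝ[X]) = 2 := map_ofNat C 2
  have e1 : 2 * X * (1 + X) * derivative (legendreShift n) =
      X * (C 2 * derivative (legendreShift n)) + X * (X * (C 2 * derivative (legendreShift n))) := by
    simp [hC2]; ring
  have e2 : ((n : ℝ[X]) + 1) * (legendreShift (n + 1) - (1 + 2 * X) * legendreShift n) =
      C ((n : ℝ) + 1) * (legendreShift (n + 1) - legendreShift n) -
        X * (C (2 * ((n : ℝ) + 1)) * legendreShift n) := by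
    simp [hC2]; ring
  rw [e1, e2]
  ext k
  rcases k with _ | k
  · simp only [coeff_add, coeff_sub, coeff_C_mul, coeff_X_mul_zero, legendreShift_coeff_zero]; ring
  · have e3 : (X * (C 2 * derivative (legendreShift n))).coeff k =
        2 * k * (legendreShift n).coeff k := by
      rcases k with _ | k
      · simp
      · simp only [coeff_X_mul, coeff_C_mul, coeff_derivative]; push_cast; ring
    simp only [coeff_add, coeff_sub, coeff_C_mul, coeff_X_mul, e3, coeff_derivative]
    have hk : ((k : ℝ) + 1) ^ 2 ≠ 0 := by positivity
    apply mul_left_cancel₀ hk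
    have h1 := legendreShift_coeff_succ_right (n + 1) k
    have h2 := legendreShift_coeff_succ_right n k
    have h5 := legendreShift_coeff_succ_left n k
    push_cast at h1 h2 h5
    linear_combination (2 * ((k : ℝ) + 1) + (n + 1)) * h2 - (n + 1) * h1 - (n + 1) * (n + k + 2) * h5

open Polynomial in
theorem legendreShift_derivative_succ (n : ℕ) :
    2 * X * (1 + X) * derivative (legendreShift (n + 1)) =
      ((n : ℝ[X]) + 1) * ((1 + 2 * X) * legendreShift (n + 1) - legendreShift n) := by
  have h1 := legendreShift_derivative (n + 1)
  have h2 := legendreShift_recurrence n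
  push_cast at h1
  linear_combination h1 + h2

/-! ### The algebraic certificate for creative telescoping -/

/-- Here P, Q, P2 stand for slices n+1, n, n+2, primes for d/dx, and V(aP + bQ) for the certificate
G. Eliminating P2, P', Q' leaves a rational identity, linear in P and Q. -/
theorem telescoping_identity {K : Type*} [Field K] (n x V P Q P2 P' Q' : K)
    (hV : (1 - 2 * x) * V = 1) (hc : 1 - 3 * x ≠ 0) (hB : 2 - 3 * x ≠ 0)
    (hP2 : (n + 2) * P2 = (2 * n + 3) * (3 * (1 - 2 * x) + 2 * (1 - 3 * x) ^ 2) * V ^ 2 * P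
      - 9 * (n + 1) * V ^ 2 * Q)
    (hP' : (1 - 3 * x) * (2 - 3 * x) * P' = 2 * (n + 2) * V * ((1 - 3 * x) * (2 - 3 * x)) * P
      - (n + 1) * ((3 * (1 - 2 * x) + 2 * (1 - 3 * x) ^ 2) * V * P - 9 * V * Q))
    (hQ' : (1 - 3 * x) * (2 - 3 * x) * Q' = 2 * (n + 1) * V * ((1 - 3 * x) * (2 - 3 * x)) * Q
      - (n + 1) * ((1 - 2 * x) * P - (3 * (1 - 2 * x) + 2 * (1 - 3 * x) ^ 2) * V * Q))
    (a b a' b' : K)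
    (ha : a = -(20 * n + 30) + (114 * n + 168) * x - (198 * n + 282) * x ^ 2
      + (108 * n + 144) * x ^ 3)
    (ha' : a' = (114 * n + 168) - 2 * (198 * n + 282) * x + 3 * (108 * n + 144) * x ^ 2)
    (hb : b = 18 * (n + 1) + 27 * (n + 2) * x - (405 * n + 540) * x ^ 2 + (486 * n + 648) * x ^ 3)
    (hb' : b' = 27 * (n + 2) - 2 * (405 * n + 540) * x + 3 * (486 * n + 648) * x ^ 2) :
    2 * (n + 2) ^ 2 * P2 - 3 * (27 * n ^ 2 + 81 * n + 62) * x * P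
      + 81 * (3 * n + 2) * (3 * n + 4) * x ^ 2 * Q =
    x * (2 * V ^ 2 * (a * P + b * Q) + V * (a' * P + a * P' + (b' * Q + b * Q')))
      - (n + 2) * (V * (a * P + b * Q)) := by
  have hA : 1 - 2 * x ≠ 0 := left_ne_zero_of_mul_eq_one hV
  have hcB : (1 - 3 * x) * (2 - 3 * x) ≠ 0 := mul_ne_zero hc hB
  obtain rfl : V = (1 - 2 * x)⁻¹ := eq_inv_of_mul_eq_one_right hV
  rw [mul_comm] at hP' hQ'
  rw [← eq_div_iff hcB] at hP' hQ'
  have h : 2 * (n + 2) ^ 2 * P2 = 2 * (n + 2) * ((n + 2) * P2) := by ring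
  rw [h, hP2, hP', hQ', ha, ha', hb, hb']
  field_simp
  ring

theorem telescoping_identity_domain {K : Type*} [CommRing K] [IsDomain K] (n x V P Q P2 P' Q' : K)
    (hV : (1 - 2 * x) * V = 1) (hc : 1 - 3 * x ≠ 0) (hB : 2 - 3 * x ≠ 0)
    (hP2 : (n + 2) * P2 = (2 * n + 3) * (3 * (1 - 2 * x) + 2 * (1 - 3 * x) ^ 2) * V ^ 2 * P
      - 9 * (n + 1) * V ^ 2 * Q)
    (hP' : (1 - 3 * x) * (2 - 3 * x) * P' = 2 * (n + 2) * V * ((1 - 3 * x) * (2 - 3 * x)) * P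
      - (n + 1) * ((3 * (1 - 2 * x) + 2 * (1 - 3 * x) ^ 2) * V * P - 9 * V * Q))
    (hQ' : (1 - 3 * x) * (2 - 3 * x) * Q' = 2 * (n + 1) * V * ((1 - 3 * x) * (2 - 3 * x)) * Q
      - (n + 1) * ((1 - 2 * x) * P - (3 * (1 - 2 * x) + 2 * (1 - 3 * x) ^ 2) * V * Q))
    (a b a' b' : K)
    (ha : a = -(20 * n + 30) + (114 * n + 168) * x - (198 * n + 282) * x ^ 2
      + (108 * n + 144) * x ^ 3)
    (ha' : a' = (114 * n + 168) - 2 * (198 * n + 282) * x + 3 * (108 * n + 144) * x ^ 2)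
    (hb : b = 18 * (n + 1) + 27 * (n + 2) * x - (405 * n + 540) * x ^ 2 + (486 * n + 648) * x ^ 3)
    (hb' : b' = 27 * (n + 2) - 2 * (405 * n + 540) * x + 3 * (486 * n + 648) * x ^ 2) :
    2 * (n + 2) ^ 2 * P2 - 3 * (27 * n ^ 2 + 81 * n + 62) * x * P
      + 81 * (3 * n + 2) * (3 * n + 4) * x ^ 2 * Q =
    x * (2 * V ^ 2 * (a * P + b * Q) + V * (a' * P + a * P' + (b' * Q + b * Q')))
      - (n + 2) * (V * (a * P + b * Q)) := by
  have inj := IsFractionRing.injective K (FractionRing K)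
  apply inj
  have h1 := congrArg (algebraMap K (FractionRing K)) hV
  have h2 := congrArg (algebraMap K (FractionRing K)) hP2
  have h3 := congrArg (algebraMap K (FractionRing K)) hP'
  have h4 := congrArg (algebraMap K (FractionRing K)) hQ'
  have h5 := (map_ne_zero_iff _ inj).2 hc
  have h6 := (map_ne_zero_iff _ inj).2 hB
  have h7 := congrArg (algebraMap K (FractionRing K)) ha
  have h8 := congrArg (algebraMap K (FractionRing K)) ha'
  have h9 := congrArg (algebraMap K (FractionRing K)) hb
  have h10 := congrArg (algebraMap K (FractionRing K)) hb'
  simp only [map_add, map_sub, map_mul, map_pow, map_one, map_ofNat, map_neg]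
    at h1 h2 h3 h4 h5 h6 h7 h8 h9 h10 ⊢
  exact telescoping_identity _ _ _ _ _ _ _ _ h1 h5 h6 h2 h3 h4 _ _ _ _ h7 h8 h9 h10

/-! ### The slices and their differential relations -/

open PowerSeries in
/-- The power series `1 / (1 - 2x)`. -/
noncomputable def geomTwo : ℝ⟦X⟧ := (1 - 2 * X)⁻¹

open PowerSeries in
theorem one_sub_two_X_mul_geomTwo : (1 - 2 * X) * geomTwo = 1 := by
  refine PowerSeries.mul_inv_cancel _ ?_
  simp

open PowerSeries in
theorem derivative_geomTwo : d⁄dX ℝ geomTwo = 2 * geomTwo ^ 2 := by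
  have h : d⁄dX ℝ (2 : ℝ⟦X⟧) = 0 := by
    simpa using (d⁄dX ℝ).map_natCast 2
  rw [geomTwo, derivative_inv']
  simp [h]
  ring

open PowerSeries in
/-- The argument `(1 - 3x)² / (3 (1 - 2x))` of the Legendre polynomials. -/
noncomputable def legendreArg : ℝ⟦X⟧ := C (1 / 3 : ℝ) * (1 - 3 * X) ^ 2 * geomTwo

open PowerSeries in
theorem three_mul_C_third : (3 : ℝ⟦X⟧) * C (1 / 3 : ℝ) = 1 := by
  rw [← map_ofNat (C (R := ℝ)) 3, ← map_mul]; norm_num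

open PowerSeries in
theorem three_mul_legendreArg : 3 * legendreArg = (1 - 3 * X) ^ 2 * geomTwo := by
  rw [legendreArg, ← mul_assoc, ← mul_assoc, three_mul_C_third, one_mul]

-- Since 1 + u = (2 - 3x)² / (3(1 - 2x)), both u and 1 + u are squares up to the same factor. The
-- right side carries the factor 2u(1 + u) of `legendreShift_derivative`.
open PowerSeries in
theorem derivative_legendreArg :
    (1 - 3 * X) * (2 - 3 * X) * d⁄dX ℝ legendreArg =
      -3 * (2 * legendreArg * (1 + legendreArg)) := by
  have h3 : d⁄dX ℝ (3 : ℝ⟦X⟧) = 0 := by simpa using (d⁄dX ℝ).map_natCast 3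
  have hu := three_mul_legendreArg
  have hd := congrArg (d⁄dX ℝ) hu
  simp only [Derivation.leibniz, Derivation.leibniz_pow, map_sub, h3, derivative_geomTwo,
    derivative_X, derivative_one, smul_eq_mul, nsmul_eq_mul] at hd
  have hV := one_sub_two_X_mul_geomTwo
  have h : (3 : ℝ⟦X⟧) ≠ 0 := left_ne_zero_of_mul_eq_one three_mul_C_third
  apply mul_left_cancel₀ h
  generalize d⁄dX ℝ legendreArg = u' at *
  generalize legendreArg = u at *
  generalize geomTwo = V at *
  generalize (X : ℝ⟦X⟧) = x at *
  norm_num at hd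
  grind

open PowerSeries in
/-- The coefficient of `yⁿ zⁿ` in `1 / (1 - 2(x+y+z) + 3(xy+yz+zx))`, as a power series in `x`. -/
noncomputable def szegoSlice (n : ℕ) : ℝ⟦X⟧ :=
  3 ^ n * geomTwo ^ (n + 1) * Polynomial.aeval legendreArg (legendreShift n)

open PowerSeries in
theorem szegoSlice_recurrence (n : ℕ) :
    ((n : ℝ⟦X⟧) + 2) * szegoSlice (n + 2) =
      (2 * (n : ℝ⟦X⟧) + 3) * (3 * (1 - 2 * X) + 2 * (1 - 3 * X) ^ 2) * geomTwo ^ 2 * szegoSlice (n + 1)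
        - 9 * ((n : ℝ⟦X⟧) + 1) * geomTwo ^ 2 * szegoSlice n := by
  have h := congrArg (Polynomial.aeval legendreArg) (legendreShift_recurrence n)
  simp only [map_mul, map_add, map_sub, map_natCast, map_one, map_ofNat, Polynomial.aeval_X] at h
  have hu := three_mul_legendreArg
  have hV := one_sub_two_X_mul_geomTwo
  simp only [szegoSlice]
  generalize Polynomial.aeval legendreArg (legendreShift n) = l at *
  generalize Polynomial.aeval legendreArg (legendreShift (n + 1)) = l1 at *
  linear_combination 9 * 3 ^ n * geomTwo ^ (n + 3) * h
    + 3 ^ n * geomTwo ^ (n + 3) * (2 * (n : ℝ⟦X⟧) + 3) * l1 * (6 * hu - 9 * hV)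

open PowerSeries in
theorem derivative_slice (n : ℕ) (l : Polynomial ℝ) :
    (1 - 3 * X) * (2 - 3 * X) *
        d⁄dX ℝ (3 ^ n * geomTwo ^ (n + 1) * Polynomial.aeval legendreArg l) =
      2 * ((n : ℝ⟦X⟧) + 1) * geomTwo * ((1 - 3 * X) * (2 - 3 * X)) *
          (3 ^ n * geomTwo ^ (n + 1) * Polynomial.aeval legendreArg l)
        - 3 * 3 ^ n * geomTwo ^ (n + 1) * Polynomial.aeval legendreArg
          (2 * Polynomial.X * (1 + Polynomial.X) * Polynomial.derivative l) := by
  have h3 : d⁄dX ℝ (3 : ℝ⟦X⟧) = 0 := by simpa using (d⁄dX ℝ).map_natCast 3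
  have hd := derivative_legendreArg
  simp only [Derivation.leibniz, Derivation.leibniz_pow, h3, derivative_geomTwo,
    Derivation.map_aeval, smul_eq_mul, nsmul_eq_mul, map_mul, map_add, map_ofNat, map_one,
    Polynomial.aeval_X, Nat.add_sub_cancel]
  push_cast
  linear_combination 3 ^ n * geomTwo ^ (n + 1) *
    Polynomial.aeval legendreArg (Polynomial.derivative l) * hd

open PowerSeries in
theorem derivative_szegoSlice (n : ℕ) :
    (1 - 3 * X) * (2 - 3 * X) * d⁄dX ℝ (szegoSlice n) =
      2 * ((n : ℝ⟦X⟧) + 1) * geomTwo * ((1 - 3 * X) * (2 - 3 * X)) * szegoSlice n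
        - ((n : ℝ⟦X⟧) + 1) * ((1 - 2 * X) * szegoSlice (n + 1)
          - (3 * (1 - 2 * X) + 2 * (1 - 3 * X) ^ 2) * geomTwo * szegoSlice n) := by
  rw [szegoSlice, derivative_slice, legendreShift_derivative]
  simp only [map_mul, map_add, map_sub, map_natCast, map_one, map_ofNat, Polynomial.aeval_X,
    szegoSlice]
  have hu := three_mul_legendreArg
  have hV := one_sub_two_X_mul_geomTwo
  generalize Polynomial.aeval legendreArg (legendreShift n) = l at *
  generalize Polynomial.aeval legendreArg (legendreShift (n + 1)) = l1 at *
  linear_combination 3 ^ n * geomTwo ^ (n + 1) * ((n : ℝ⟦X⟧) + 1) * (2 * l * hu + 3 * (l1 - l) * hV)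

open PowerSeries in
theorem derivative_szegoSlice_succ (n : ℕ) :
    (1 - 3 * X) * (2 - 3 * X) * d⁄dX ℝ (szegoSlice (n + 1)) =
      2 * ((n : ℝ⟦X⟧) + 2) * geomTwo * ((1 - 3 * X) * (2 - 3 * X)) * szegoSlice (n + 1)
        - ((n : ℝ⟦X⟧) + 1) * ((3 * (1 - 2 * X) + 2 * (1 - 3 * X) ^ 2) * geomTwo * szegoSlice (n + 1)
          - 9 * geomTwo * szegoSlice n) := by
  rw [szegoSlice, derivative_slice, legendreShift_derivative_succ]
  simp only [map_mul, map_add, map_sub, map_natCast, map_one, map_ofNat, Polynomial.aeval_X,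
    szegoSlice]
  push_cast
  have hu := three_mul_legendreArg
  have hV := one_sub_two_X_mul_geomTwo
  generalize Polynomial.aeval legendreArg (legendreShift n) = l at *
  generalize Polynomial.aeval legendreArg (legendreShift (n + 1)) = l1 at *
  linear_combination 3 ^ n * geomTwo ^ (n + 2) * ((n : ℝ⟦X⟧) + 1) * (-6 * l1 * hu + 9 * l1 * hV)

/-! ### Telescoping and the recurrence for diagonal coefficients -/

open PowerSeries in
/-- A coefficient functional that is blind to total derivatives. -/
theorem coeff_X_mul_derivative_sub (G : ℝ⟦X⟧) (m : ℕ) :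
    coeff m (X * d⁄dX ℝ G - (m : ℝ⟦X⟧) * G) = 0 := by
  have h : (m : ℝ⟦X⟧) = C (m : ℝ) := by simp
  rw [map_sub, h, coeff_C_mul]
  rcases m with _ | m
  · simp
  · rw [coeff_succ_X_mul, coeff_derivative]
    push_cast
    ring

open PowerSeries in
theorem szegoSlice_telescoping (n : ℕ) : ∃ G : ℝ⟦X⟧,
    2 * ((n : ℝ⟦X⟧) + 2) ^ 2 * szegoSlice (n + 2)
      - 3 * (27 * (n : ℝ⟦X⟧) ^ 2 + 81 * (n : ℝ⟦X⟧) + 62) * X * szegoSlice (n + 1)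
      + 81 * (3 * (n : ℝ⟦X⟧) + 2) * (3 * (n : ℝ⟦X⟧) + 4) * X ^ 2 * szegoSlice n =
    X * d⁄dX ℝ G - ((n + 2 : ℕ) : ℝ⟦X⟧) * G := by
  let a : ℝ⟦X⟧ := -(20 * (n : ℝ⟦X⟧) + 30) + (114 * (n : ℝ⟦X⟧) + 168) * X
    - (198 * (n : ℝ⟦X⟧) + 282) * X ^ 2 + (108 * (n : ℝ⟦X⟧) + 144) * X ^ 3
  let b : ℝ⟦X⟧ := 18 * ((n : ℝ⟦X⟧) + 1) + 27 * ((n : ℝ⟦X⟧) + 2) * X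
    - (405 * (n : ℝ⟦X⟧) + 540) * X ^ 2 + (486 * (n : ℝ⟦X⟧) + 648) * X ^ 3
  have hnum : ∀ m : ℕ, d⁄dX ℝ (m : ℝ⟦X⟧) = 0 := fun m => (d⁄dX ℝ).map_natCast m
  have hof : ∀ (m : ℕ) [m.AtLeastTwo], d⁄dX ℝ (OfNat.ofNat m : ℝ⟦X⟧) = 0 := fun m _ => by
    rw [← Nat.cast_ofNat]; exact hnum _
  have ha : d⁄dX ℝ a = (114 * (n : ℝ⟦X⟧) + 168) - 2 * (198 * (n : ℝ⟦X⟧) + 282) * X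
      + 3 * (108 * (n : ℝ⟦X⟧) + 144) * X ^ 2 := by
    simp only [a, map_add, map_sub, map_neg, Derivation.leibniz, Derivation.leibniz_pow, hnum, hof,
      derivative_X, smul_eq_mul, nsmul_eq_mul]
    push_cast
    ring
  have hb : d⁄dX ℝ b = 27 * ((n : ℝ⟦X⟧) + 2) - 2 * (405 * (n : ℝ⟦X⟧) + 540) * X
      + 3 * (486 * (n : ℝ⟦X⟧) + 648) * X ^ 2 := by
    simp only [b, map_add, map_sub, Derivation.leibniz, Derivation.leibniz_pow, hnum, hof,
      derivative_X, derivative_one, smul_eq_mul, nsmul_eq_mul]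
    push_cast
    ring
  refine ⟨geomTwo * (a * szegoSlice (n + 1) + b * szegoSlice n), ?_⟩
  have hG : d⁄dX ℝ (geomTwo * (a * szegoSlice (n + 1) + b * szegoSlice n)) =
      2 * geomTwo ^ 2 * (a * szegoSlice (n + 1) + b * szegoSlice n)
        + geomTwo * (d⁄dX ℝ a * szegoSlice (n + 1) + a * d⁄dX ℝ (szegoSlice (n + 1))
          + (d⁄dX ℝ b * szegoSlice n + b * d⁄dX ℝ (szegoSlice n))) := by
    simp only [Derivation.leibniz, map_add, derivative_geomTwo, smul_eq_mul]
    ring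
  rw [hG]
  have hc : (1 - 3 * X : ℝ⟦X⟧) ≠ 0 := fun h => by simpa using congrArg constantCoeff h
  have hB : (2 - 3 * X : ℝ⟦X⟧) ≠ 0 := fun h => by
    simpa [map_ofNat] using congrArg constantCoeff h
  have key := telescoping_identity_domain _ _ _ _ _ _ _ _ one_sub_two_X_mul_geomTwo hc hB
    (szegoSlice_recurrence n) (derivative_szegoSlice_succ n) (derivative_szegoSlice n)
    a b _ _ rfl ha rfl hb
  rw [key]
  push_cast
  rfl

theorem coeff_szegoSlice_recurrence (n : ℕ) :
    2 * ((n : ℝ) + 2) ^ 2 * PowerSeries.coeff (n + 2) (szegoSlice (n + 2)) =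
      3 * (27 * (n : ℝ) ^ 2 + 81 * n + 62) * PowerSeries.coeff (n + 1) (szegoSlice (n + 1))
        - 81 * (3 * (n : ℝ) + 2) * (3 * n + 4) * PowerSeries.coeff n (szegoSlice n) := by
  obtain ⟨G, hG⟩ := szegoSlice_telescoping n
  have h := congrArg (PowerSeries.coeff (n + 2)) hG
  rw [coeff_X_mul_derivative_sub] at h
  have e : 2 * ((n : PowerSeries ℝ) + 2) ^ 2 * szegoSlice (n + 2)
      - 3 * (27 * (n : PowerSeries ℝ) ^ 2 + 81 * (n : PowerSeries ℝ) + 62) * PowerSeries.X * szegoSlice (n + 1)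
      + 81 * (3 * (n : PowerSeries ℝ) + 2) * (3 * (n : PowerSeries ℝ) + 4) * PowerSeries.X ^ 2 * szegoSlice n =
      PowerSeries.C (2 * ((n : ℝ) + 2) ^ 2) * szegoSlice (n + 2)
      - PowerSeries.C (3 * (27 * (n : ℝ) ^ 2 + 81 * n + 62)) *
        (PowerSeries.X * szegoSlice (n + 1))
      + PowerSeries.C (81 * (3 * (n : ℝ) + 2) * (3 * n + 4)) *
        (PowerSeries.X * (PowerSeries.X * szegoSlice n)) := by
    simp only [map_add, map_mul, map_pow, map_ofNat, map_natCast]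
    ring
  rw [e] at h
  simp only [map_add, map_sub, PowerSeries.coeff_C_mul, PowerSeries.coeff_succ_X_mul] at h
  linarith

theorem coeff_szegoSlice_zero : PowerSeries.coeff 0 (szegoSlice 0) = 1 := by
  simp [szegoSlice, legendreShift, geomTwo]

theorem coeff_szegoSlice_one : PowerSeries.coeff 1 (szegoSlice 1) = 12 := by
  have hu := three_mul_legendreArg
  have hV := one_sub_two_X_mul_geomTwo
  -- The slice is 3V² + 2V³(1 - 3x)² with V = `geomTwo`; all terms beyond the linear one are
  -- collected behind x².
  have e : szegoSlice 1 = PowerSeries.C 5 + PowerSeries.X * (PowerSeries.C 12 +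
      PowerSeries.X * (geomTwo ^ 3 * (30 - 104 * PowerSeries.X + 96 * PowerSeries.X ^ 2))) := by
    simp only [szegoSlice, legendreShift, Finset.sum_range_succ, Finset.sum_range_zero]
    norm_num
    rw [map_ofNat PowerSeries.C 2, map_ofNat PowerSeries.C 5, map_ofNat PowerSeries.C 12]
    generalize geomTwo = V at *
    generalize legendreArg = u at *
    generalize (PowerSeries.X : PowerSeries ℝ) = x at *
    grind
  rw [e, map_add, PowerSeries.coeff_succ_X_mul]
  simp

/-! ### Extracting the coefficients in y and z -/

open PowerSeries in
/-- The geometric series for the inverse of `a - b y`, where `v` is the inverse of `a`. -/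
noncomputable def linearInv {R : Type*} [CommRing R] (v b : R) : R⟦X⟧ :=
  C v * rescale (b * v) (mk 1)

open PowerSeries in
theorem linear_mul_linearInv {R : Type*} [CommRing R] {a v : R} (h : a * v = 1) (b : R) :
    (C a - C b * X) * linearInv v b = 1 := by
  have h1 := congrArg (rescale (b * v)) (mk_one_mul_one_sub_eq_one R)
  rw [map_mul, map_sub, map_one, rescale_X, map_mul] at h1
  have h2 : (C a : R⟦X⟧) * C v = 1 := by rw [← map_mul, h, map_one]
  rw [linearInv]
  linear_combination h1 + rescale (b * v) (mk 1) * h2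

open PowerSeries in
theorem coeff_linearInv_pow {R : Type*} [CommRing R] (v b : R) (k n : ℕ) :
    coeff n (linearInv v b ^ (k + 1)) = ((k + n).choose k : R) * b ^ n * v ^ (n + k + 1) := by
  rw [linearInv, mul_pow, ← map_pow, ← map_pow, mk_one_pow_eq_mk_choose_add, coeff_C_mul,
    coeff_rescale, coeff_mk]
  ring

-- From b(b - dy) = (b² - da) + d(a - by), the binomial theorem applies, and each factor a - by
-- cancels one factor of the inverse. The auxiliary bⁿ is cancelled at the end.
open PowerSeries in
theorem coeff_pow_mul_linearInv_pow {R : Type*} [CommRing R] [IsDomain R] {a v b d : R}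
    (h : a * v = 1) (hb : b ≠ 0) (n : ℕ) :
    coeff n ((C b - C d * X) ^ n * linearInv v b ^ (n + 1)) =
      ∑ k ∈ Finset.range (n + 1), ((n.choose k : R) * ((n + k).choose k : R)) *
        (d ^ (n - k) * (b ^ 2 - d * a) ^ k * v ^ (n + k + 1)) := by
  have e : (C b : R⟦X⟧) * (C b - C d * X) = C (b ^ 2 - d * a) + C d * (C a - C b * X) := by
    simp only [map_sub, map_mul, map_pow]
    ring
  apply mul_left_cancel₀ (pow_ne_zero n hb)
  rw [← coeff_C_mul, map_pow, ← mul_assoc, ← mul_pow, e, add_pow, Finset.sum_mul, map_sum,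
    Finset.mul_sum]
  refine Finset.sum_congr rfl fun k hk => ?_
  have h1 : (C a - C b * X) ^ (n - k) * linearInv v b ^ (n + 1) = linearInv v b ^ (k + 1) := by
    have : linearInv v b ^ (n + 1) = linearInv v b ^ (n - k) * linearInv v b ^ (k + 1) := by
      rw [← pow_add]; congr 1; have := Finset.mem_range.1 hk; omega
    rw [this, ← mul_assoc, ← mul_pow, linear_mul_linearInv h, one_pow, one_mul]
  have h2 : C (b ^ 2 - d * a) ^ k * (C d * (C a - C b * X)) ^ (n - k) * (n.choose k : R⟦X⟧) *
      linearInv v b ^ (n + 1) =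
      C ((b ^ 2 - d * a) ^ k * d ^ (n - k) * (n.choose k : R)) * linearInv v b ^ (k + 1) := by
    rw [← h1, mul_pow (C d)]
    simp only [map_mul, map_pow, map_natCast]
    ring
  rw [h2, coeff_C_mul, coeff_linearInv_pow, add_comm k n]
  ring

open PowerSeries in
theorem szegoSlice_eq_sum (n : ℕ) :
    szegoSlice n = ∑ k ∈ Finset.range (n + 1),
      ((n.choose k : ℝ⟦X⟧) * ((n + k).choose k : ℝ⟦X⟧)) *
        (3 ^ (n - k) * ((2 - 3 * X) ^ 2 - 3 * (1 - 2 * X)) ^ k * geomTwo ^ (n + k + 1)) := by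
  rw [szegoSlice, legendreShift, map_sum, Finset.mul_sum]
  refine Finset.sum_congr rfl fun k hk => ?_
  have hk' : 3 ^ n = (3 : ℝ⟦X⟧) ^ (n - k) * 3 ^ k := by
    rw [← pow_add]; congr 1; have := Finset.mem_range.1 hk; omega
  have hu : (3 : ℝ⟦X⟧) ^ k * legendreArg ^ k =
      ((2 - 3 * X) ^ 2 - 3 * (1 - 2 * X)) ^ k * geomTwo ^ k := by
    rw [← mul_pow, three_mul_legendreArg, ← mul_pow]; ring
  simp only [map_mul, map_natCast, map_pow, Polynomial.aeval_X]
  rw [hk']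
  linear_combination ((n.choose k : ℝ⟦X⟧) * ((n + k).choose k : ℝ⟦X⟧)) * 3 ^ (n - k) *
    geomTwo ^ (n + 1) * hu

open PowerSeries in
theorem coeff_eq_szegoSlice (n : ℕ) :
    coeff n ((C (2 - 3 * X : ℝ⟦X⟧) - C 3 * X) ^ n * linearInv geomTwo (2 - 3 * X) ^ (n + 1)) =
      szegoSlice n := by
  have hb : (2 - 3 * X : ℝ⟦X⟧) ≠ 0 := fun h => by
    simpa [map_ofNat] using congrArg constantCoeff h
  rw [coeff_pow_mul_linearInv_pow one_sub_two_X_mul_geomTwo hb, szegoSlice_eq_sum]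

open PowerSeries in
/-- A power series in `z` over `R` inverting `p - q z` has coefficients `qⁿ p⁻ⁿ⁻¹`. -/
theorem coeff_of_linear_mul_eq_one {R : Type*} [CommRing R] {p q w : R} (hw : p * w = 1)
    {T : R⟦X⟧} (hT : (C p - C q * X) * T = 1) (n : ℕ) : coeff n T = q ^ n * w ^ (n + 1) := by
  have h : T = linearInv w q :=
    (left_inv_eq_right_inv (by rw [mul_comm]; exact hT) (linear_mul_linearInv hw q))
  rw [h]
  simpa using coeff_linearInv_pow w q 0 n

/-! ### Passing from three variables to nested power series -/

/-- The exponent `(i, j, k)`. -/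
noncomputable def tripleExponent (i j k : ℕ) : Fin 3 →₀ ℕ :=
  Finsupp.equivFunOnFinite.symm ![i, j, k]

/-- A power series in `x, y, z` read as a power series in `z` over power series in `y` over power
series in `x`. -/
noncomputable def nestSeries (f : MvPowerSeries (Fin 3) ℝ) :
    PowerSeries (PowerSeries (PowerSeries ℝ)) :=
  PowerSeries.mk fun k => PowerSeries.mk fun j => PowerSeries.mk fun i =>
    MvPowerSeries.coeff (tripleExponent i j k) f

theorem coeff_nestSeries (f : MvPowerSeries (Fin 3) ℝ) (i j k : ℕ) :
    PowerSeries.coeff i (PowerSeries.coeff j (PowerSeries.coeff k (nestSeries f))) =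
      MvPowerSeries.coeff (tripleExponent i j k) f := by
  simp [nestSeries]

theorem nestSeries_ext {F G : PowerSeries (PowerSeries (PowerSeries ℝ))}
    (h : ∀ i j k, PowerSeries.coeff i (PowerSeries.coeff j (PowerSeries.coeff k F)) =
      PowerSeries.coeff i (PowerSeries.coeff j (PowerSeries.coeff k G))) : F = G := by
  ext k j i
  exact h i j k

/-- Full multiplicativity of `nestSeries` is not needed: the denominator is a polynomial, so
linearity and multiplication by constants and variables suffice. -/
theorem nestSeries_add (f g : MvPowerSeries (Fin 3) ℝ) :
    nestSeries (f + g) = nestSeries f + nestSeries g :=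
  nestSeries_ext fun i j k => by simp [coeff_nestSeries]

theorem nestSeries_sub (f g : MvPowerSeries (Fin 3) ℝ) :
    nestSeries (f - g) = nestSeries f - nestSeries g :=
  nestSeries_ext fun i j k => by simp [coeff_nestSeries]

theorem nestSeries_C_mul (a : ℝ) (f : MvPowerSeries (Fin 3) ℝ) :
    nestSeries (MvPowerSeries.C a * f) =
      PowerSeries.C (PowerSeries.C (PowerSeries.C a)) * nestSeries f :=
  nestSeries_ext fun i j k => by
    simp only [coeff_nestSeries, PowerSeries.coeff_C_mul, MvPowerSeries.coeff_C_mul]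

theorem nestSeries_one : nestSeries 1 = 1 :=
  nestSeries_ext fun i j k => by
    have h : tripleExponent i j k = 0 ↔ i = 0 ∧ j = 0 ∧ k = 0 := by
      simp [tripleExponent, Finsupp.ext_iff, Fin.forall_fin_succ]
    rw [coeff_nestSeries, MvPowerSeries.coeff_one]
    simp only [h, PowerSeries.coeff_one]
    by_cases hk : k = 0 <;> by_cases hj : j = 0 <;> by_cases hi : i = 0 <;>
      simp [hk, hj, hi, PowerSeries.coeff_one]

theorem MvPowerSeries.coeff_X_mul_of_eq_zero {σ : Type*} (m : σ →₀ ℕ) (s : σ)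
    (f : MvPowerSeries σ ℝ) (h : m s = 0) :
    MvPowerSeries.coeff m (MvPowerSeries.X s * f) = 0 := by
  classical
  rw [MvPowerSeries.X, MvPowerSeries.coeff_monomial_mul, if_neg]
  intro hle
  simpa [h] using hle s

theorem MvPowerSeries.coeff_X_mul_of_eq_add {σ : Type*} (m m' : σ →₀ ℕ) (s : σ)
    (f : MvPowerSeries σ ℝ) (h : m = Finsupp.single s 1 + m') :
    MvPowerSeries.coeff m (MvPowerSeries.X s * f) = MvPowerSeries.coeff m' f := by
  rw [h, MvPowerSeries.X, MvPowerSeries.coeff_add_monomial_mul, one_mul]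

theorem nestSeries_X0_mul (f : MvPowerSeries (Fin 3) ℝ) :
    nestSeries (MvPowerSeries.X 0 * f) =
      PowerSeries.C (PowerSeries.C PowerSeries.X) * nestSeries f :=
  nestSeries_ext fun i j k => by
    rw [coeff_nestSeries, PowerSeries.coeff_C_mul, PowerSeries.coeff_C_mul]
    rcases i with _ | i
    · rw [MvPowerSeries.coeff_X_mul_of_eq_zero _ _ _ (by simp [tripleExponent])]
      simp
    · rw [PowerSeries.coeff_succ_X_mul, coeff_nestSeries]
      apply MvPowerSeries.coeff_X_mul_of_eq_add
      ext s
      fin_cases s <;> simp [tripleExponent, add_comm]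

theorem nestSeries_X1_mul (f : MvPowerSeries (Fin 3) ℝ) :
    nestSeries (MvPowerSeries.X 1 * f) = PowerSeries.C PowerSeries.X * nestSeries f :=
  nestSeries_ext fun i j k => by
    rw [coeff_nestSeries, PowerSeries.coeff_C_mul]
    rcases j with _ | j
    · rw [MvPowerSeries.coeff_X_mul_of_eq_zero _ _ _ (by simp [tripleExponent])]
      simp
    · rw [PowerSeries.coeff_succ_X_mul, coeff_nestSeries]
      apply MvPowerSeries.coeff_X_mul_of_eq_add
      ext s
      fin_cases s <;> simp [tripleExponent, add_comm]

theorem nestSeries_X2_mul (f : MvPowerSeries (Fin 3) ℝ) :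
    nestSeries (MvPowerSeries.X 2 * f) = PowerSeries.X * nestSeries f :=
  nestSeries_ext fun i j k => by
    rw [coeff_nestSeries]
    rcases k with _ | k
    · rw [MvPowerSeries.coeff_X_mul_of_eq_zero _ _ _ (by simp [tripleExponent])]
      simp
    · rw [PowerSeries.coeff_succ_X_mul, coeff_nestSeries]
      apply MvPowerSeries.coeff_X_mul_of_eq_add
      ext s
      fin_cases s <;> simp [tripleExponent, add_comm]

theorem MvPowerSeries.rescale_X' {σ : Type*} (a : σ → ℝ) (s : σ) :
    MvPowerSeries.rescale a (MvPowerSeries.X s) =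
      MvPowerSeries.C (a s) * MvPowerSeries.X s := by
  classical
  ext m
  rw [MvPowerSeries.coeff_rescale, MvPowerSeries.coeff_C_mul, MvPowerSeries.coeff_X]
  split_ifs with h
  · subst h; simp
  · simp

theorem MvPowerSeries.rescale_C' {σ : Type*} (a : σ → ℝ) (r : ℝ) :
    MvPowerSeries.rescale a (MvPowerSeries.C r) = MvPowerSeries.C r := by
  classical
  ext m
  rw [MvPowerSeries.coeff_rescale, MvPowerSeries.coeff_C]
  split_ifs with h
  · subst h; simp
  · simp

theorem nestSeries_szegoScaled :
    (PowerSeries.C (PowerSeries.C (1 - 2 * PowerSeries.X : PowerSeries ℝ)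
        - PowerSeries.C (2 - 3 * PowerSeries.X : PowerSeries ℝ) * PowerSeries.X)
      - PowerSeries.C (PowerSeries.C (2 - 3 * PowerSeries.X : PowerSeries ℝ)
        - PowerSeries.C 3 * PowerSeries.X) * PowerSeries.X) * nestSeries szegoScaled = 1 := by
  have h := congrArg (MvPowerSeries.rescale fun _ : Fin 3 => (2 : ℝ)) szegoDenominator_mul_szegoS
  have hden : MvPowerSeries.rescale (fun _ : Fin 3 => (2 : ℝ)) szegoDenominator * szegoScaled =
      szegoScaled - MvPowerSeries.C 2 * (MvPowerSeries.X 0 * szegoScaled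
        + MvPowerSeries.X 1 * szegoScaled + MvPowerSeries.X 2 * szegoScaled)
      + MvPowerSeries.C 3 * (MvPowerSeries.X 0 * (MvPowerSeries.X 1 * szegoScaled)
        + MvPowerSeries.X 1 * (MvPowerSeries.X 2 * szegoScaled)
        + MvPowerSeries.X 2 * (MvPowerSeries.X 0 * szegoScaled)) := by
    have h3 : (MvPowerSeries.C (3 / 4) : MvPowerSeries (Fin 3) ℝ) *
        (MvPowerSeries.C 2 * MvPowerSeries.C 2) = MvPowerSeries.C 3 := by
      rw [← map_mul, ← map_mul]; norm_num
    simp only [szegoDenominator, map_add, map_sub, map_mul, map_one, MvPowerSeries.rescale_X',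
      MvPowerSeries.rescale_C']
    rw [← h3]
    ring
  rw [map_mul, map_one, ← szegoScaled, hden] at h
  have h' := congrArg nestSeries h
  simp only [nestSeries_add, nestSeries_sub, nestSeries_C_mul, nestSeries_X0_mul,
    nestSeries_X1_mul, nestSeries_X2_mul, nestSeries_one] at h'
  rw [← h']
  simp only [map_sub, map_mul, map_one, map_ofNat]
  ring

theorem szegoDiagonal_eq (n : ℕ) : szegoDiagonal n = PowerSeries.coeff n (szegoSlice n) := by
  rw [← coeff_eq_szegoSlice, ← coeff_of_linear_mul_eq_one
    (linear_mul_linearInv one_sub_two_X_mul_geomTwo _) nestSeries_szegoScaled, coeff_nestSeries,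
    szegoDiagonal, tripleExponent]
  congr 2
  ext s
  fin_cases s <;> rfl

/-! ### Recurrence and positivity -/

theorem szegoDiagonal_recurrence (n : ℕ) :
    2 * ((n : ℝ) + 2) ^ 2 * szegoDiagonal (n + 2) =
      3 * (27 * (n : ℝ) ^ 2 + 81 * n + 62) * szegoDiagonal (n + 1)
        - 81 * (3 * (n : ℝ) + 2) * (3 * n + 4) * szegoDiagonal n := by
  simp only [szegoDiagonal_eq, coeff_szegoSlice_recurrence]

theorem szegoDiagonal_zero : szegoDiagonal 0 = 1 := by
  rw [szegoDiagonal_eq, coeff_szegoSlice_zero]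

theorem szegoDiagonal_one : szegoDiagonal 1 = 12 := by
  rw [szegoDiagonal_eq, coeff_szegoSlice_one]

theorem szegoDiagonal_two : szegoDiagonal 2 = 198 := by
  have h := szegoDiagonal_recurrence 0
  rw [szegoDiagonal_zero, szegoDiagonal_one] at h
  norm_num at h
  linarith

theorem szegoDiagonal_three : szegoDiagonal 3 = 3720 := by
  have h := szegoDiagonal_recurrence 1
  rw [szegoDiagonal_one, szegoDiagonal_two] at h
  norm_num at h
  linarith

/-- The index starts at 2 because the earlier ratios, 12 and 16.5, are below 18, while 3720/198
exceeds it. -/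
theorem szegoDiagonal_pos_and_growth (n : ℕ) :
    0 < szegoDiagonal (n + 2) ∧ 18 * szegoDiagonal (n + 2) ≤ szegoDiagonal (n + 3) := by
  induction n with
  | zero => norm_num [szegoDiagonal_two, szegoDiagonal_three]
  | succ n ih =>
    obtain ⟨h0, h1⟩ := ih
    have h2 : 0 < szegoDiagonal (n + 3) := by linarith
    refine ⟨h2, ?_⟩
    have h := szegoDiagonal_recurrence (n + 2)
    push_cast at h
    rw [show n + 2 + 2 = n + 1 + 3 by omega, show n + 2 + 1 = n + 3 by omega] at h
    rw [show n + 1 + 2 = n + 3 by omega]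
    have hn : (0 : ℝ) ≤ n := Nat.cast_nonneg n
    have hc : 0 < 2 * ((n : ℝ) + 2 + 2) ^ 2 := by positivity
    have hd : 0 ≤ 81 * (3 * ((n : ℝ) + 2) + 2) * (3 * ((n : ℝ) + 2) + 4) := by positivity
    -- Bounding s_{n+2} by s_{n+3}/18 leaves a surplus of (9n² + 72n + 120)/2 times s_{n+3}; `h4`
    -- covers most of its double.
    have h3 := mul_le_mul_of_nonneg_left h1 hd
    have h4 : 0 ≤ (9 * (n : ℝ) ^ 2 + 63 * n + 87) * szegoDiagonal (n + 3) := by positivity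
    refine le_of_mul_le_mul_left ?_ hc
    rw [h]
    nlinarith

theorem mainTheorem3 : ∀ n : ℕ, 0 < szegoDiagonal n := by
  rintro (_ | _ | n)
  · rw [szegoDiagonal_zero]; norm_num
  · rw [zero_add, szegoDiagonal_one]; norm_num
  · exact (szegoDiagonal_pos_and_growth n).1
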